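/- For $k\ge 1$ let $\chi_k$ denote the chi distribution with $k$ degrees of freedom, i.e. the law of $\sqrt{x_1^2+\dots+x_k^2}$ for independent standard normal $x_1,\dots,x_k$. Let $1\le d\le D$. Let $IP$ be a fixed or random $d$-dimensional affine subspace of $\mathbb{R}^D$, with direction $W$ and orthogonal projection $\Pi$ onto $W$. Let the splitter be a random affine hyperplane in $\mathbb{R}^D$ with normal vector $v\sim N(0,I_D)$, where $v$ is independent of $W$. Let $\alpha$ be the dihedral angle between the splitter and $IP$: if $d=D-1$, it is the angle between a normal vector of the splitter and a normal vector of $IP$; otherwise $\alpha=\pi/2-\angle(v,\Pi v)$ (with $\angle(v,0)=\pi/2$). 1. Almost surely $\sin\alpha=\|\Pi v\|/\|v\|$, where $\|\Pi v\|$ has law $\chi_d$ and $\|v\|$ has law $\chi_D$. 2. If $d$ is fixed and $D\to\infty$, then $\sin\alpha$ behaves like $\chi_d/\sqrt{D-\tfrac12}$: $\sqrt{D-\tfrac12}\,\sin\alpha$ converges in distribution to $\chi_d$, and so does $\sqrt{D}\,\sin\alpha$. 3. If $d\to\infty$ and $D\to\infty$ with $d/D\to 0$, then $\sin\alpha$ is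 asymptotically $N\!\left(\frac{\sqrt{d-1/2}}{\sqrt{D-1/2}},\frac1{2D-1}\right)$, i.e. $$\frac{\sin\alpha-\sqrt{d-\frac12}\big/\sqrt{D-\frac12}}{\sqrt{1/(2D-1)}}\longrightarrow N(0,1)\quad\text{in distribution.}$$ -/

import Mathlib

open MeasureTheory ProbabilityTheory Filter Topology

noncomputable section

/-- The chi distribution with `k` degrees of freedom: the law of `√(x₁² + ⋯ + x_k²)` where
`x₁, …, x_k` are independent standard normal variables. -/
def chiMeasure (k : ℕ) : Measure ℝ :=
  (Measure.pi fun _ : Fin k => gaussianReal 0 1).map fun x => √(∑ i, x i ^ 2)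

instance (k : ℕ) : IsProbabilityMeasure (chiMeasure k) :=
  Measure.isProbabilityMeasure_map (Measurable.aemeasurable (by fun_prop))

section Geometry

variable {E : Type*} [NormedAddCommGroup E] [InnerProductSpace ℝ E] [FiniteDimensional ℝ E]

/-- The affine hyperplane through `p` with normal vector `v`. -/
def splitter (p v : E) : AffineSubspace ℝ E :=
  AffineSubspace.mk' p (Submodule.span ℝ {v})ᗮ

/-- `α` is a dihedral angle between the hyperplane `S` and the affine subspace `A`.
If `A` also has codimension one, it is the angle between a normal vector of `S` and a normal
vector of `A` (the two orientations give `α` and `π - α`).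
Otherwise it is `π / 2` minus the angle between a normal vector `m` of `S` and the orthogonal
projection of `m` onto the direction of `A`; if this projection vanishes, then the angle in
question is `π / 2` (the convention of `InnerProductGeometry.angle`), and `α = 0`. -/
def IsDihedralAngle (S A : AffineSubspace ℝ E) (α : ℝ) : Prop :=
  (Module.finrank ℝ A.direction + 1 = Module.finrank ℝ E ∧
    ∃ m ∈ S.directionᗮ, ∃ n ∈ A.directionᗮ, m ≠ 0 ∧ n ≠ 0 ∧
      α = InnerProductGeometry.angle m n) ∨
  (Module.finrank ℝ A.direction + 1 ≠ Module.finrank ℝ E ∧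
    ∃ m ∈ S.directionᗮ, m ≠ 0 ∧
      α = Real.pi / 2 - InnerProductGeometry.angle m (A.direction.starProjection m))

end Geometry

/-- On the probability space `(Ω, P)`, `IP` is a (possibly random) `d`-dimensional affine subspace
of `ℝ^D`, `v ∼ N(0, I_D)` is a normal vector, independent of the direction of `IP`, of a hyperplane
passing through an arbitrary point `p`, and `α` is the dihedral angle of that hyperplane and `IP`.
A random linear subspace is regarded as a random element through its orthogonal projection. -/
structure IsRandomSplit {Ω : Type*} [MeasurableSpace Ω] (P : Measure Ω) (d D : ℕ)
    (IP : Ω → AffineSubspace ℝ (EuclideanSpace ℝ (Fin D)))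
    (p v : Ω → EuclideanSpace ℝ (Fin D)) (α : Ω → ℝ) : Prop where
  finrank_direction : ∀ ω, Module.finrank ℝ (IP ω).direction = d
  aemeasurable_direction : AEMeasurable (fun ω => (IP ω).direction.starProjection) P
  hasLaw_normal : HasLaw v (stdGaussian (EuclideanSpace ℝ (Fin D))) P
  indepFun : IndepFun (fun ω => (IP ω).direction.starProjection) v P
  isDihedralAngle : ∀ᵐ ω ∂P, IsDihedralAngle (splitter (p ω) (v ω)) (IP ω) (α ω)

end

/-! ### Geometry of the dihedral angle -/

section Geometry

variable {E : Type*} [NormedAddCommGroup E] [InnerProductSpace ℝ E] [FiniteDimensional ℝ E]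

/-! Both conventions for the angle give `sin α = ‖Πv‖ / ‖v‖`. A standard Gaussian vector has
independent standard normal coordinates in every orthonormal basis, in particular in one adapted to
`W`; independence extends this from fixed to random `W`. So `(‖Πv‖, ‖v‖)` has the law of `(√S_d,
√S_D)`, where `S_k` is the sum of the first `k` squares of a single i.i.d. normal sequence, and all
`n` can be treated on one probability space. For fixed `d`, the law of large numbers `S_D / D → 1`
suffices. For `d → ∞`, the central limit theorem for `S_k` gives Fisher's approximation: `U_k = √2
(√S_k - √(k - 1/2))` tends to `N(0,1)`. The normalized sine equals `U_d · √(D - 1/2)/√S_D - U_D ·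
√(d - 1/2)/√S_D`, whose factors tend to 1 and 0, so Slutsky's theorem concludes. Numerator and
denominator need not be independent. -/

theorem cos_angle_starProjection (K : Submodule ℝ E) (m : E) :
    Real.cos (InnerProductGeometry.angle m (K.starProjection m)) = ‖K.starProjection m‖ / ‖m‖ := by
  rw [InnerProductGeometry.cos_angle]
  have h : inner ℝ m (K.starProjection m) = ‖K.starProjection m‖ ^ 2 := by
    rw [← real_inner_self_eq_norm_sq, Submodule.inner_starProjection_left_eq_right,
      Submodule.starProjection_eq_self_iff.2 (K.starProjection_apply_mem m)]
  rw [h]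
  rcases eq_or_ne (‖K.starProjection m‖) 0 with h0 | h0
  · simp [h0]
  · rcases eq_or_ne ‖m‖ 0 with h1 | h1
    · simp [h1]
    · field_simp

/-- In codimension one `Kᗮ` is the line through `n`, so `m` is its projection to `K` plus `c • n`,
and Pythagoras applies. The sign of `c` plays no role. -/
theorem sin_angle_of_mem_orthogonal {K : Submodule ℝ E}
    (hK : Module.finrank ℝ K + 1 = Module.finrank ℝ E) {m n : E} (hn : n ∈ Kᗮ)
    (hm0 : m ≠ 0) (hn0 : n ≠ 0) :
    Real.sin (InnerProductGeometry.angle m n) = ‖K.starProjection m‖ / ‖m‖ := by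
  have hm0' : ‖m‖ ≠ 0 := norm_ne_zero_iff.2 hm0
  have hn0' : ‖n‖ ≠ 0 := norm_ne_zero_iff.2 hn0
  have h1 : Module.finrank ℝ Kᗮ = 1 := by
    have := K.finrank_add_finrank_orthogonal
    omega
  obtain ⟨c, hc⟩ : ∃ c : ℝ, c • n = Kᗮ.starProjection m := by
    obtain ⟨c, hc⟩ := (finrank_eq_one_iff_of_nonzero' (⟨n, hn⟩ : Kᗮ) (by simpa using hn0)).1 h1
      ⟨Kᗮ.starProjection m, Kᗮ.starProjection_apply_mem m⟩
    exact ⟨c, congrArg Subtype.val hc⟩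
  have hdec : m = K.starProjection m + c • n := by
    rw [hc]; exact (K.starProjection_add_starProjection_orthogonal m).symm
  have horth : inner ℝ (K.starProjection m) n = 0 := hn _ (K.starProjection_apply_mem m)
  have hinner : inner ℝ m n = c * ‖n‖ ^ 2 := by
    conv_lhs => rw [hdec]
    rw [inner_add_left, horth, real_inner_smul_left, real_inner_self_eq_norm_sq, zero_add]
  have hnorm : ‖m‖ ^ 2 = ‖K.starProjection m‖ ^ 2 + c ^ 2 * ‖n‖ ^ 2 := by
    conv_lhs => rw [hdec]
    rw [← real_inner_self_eq_norm_sq, inner_add_left, inner_add_right, inner_add_right,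
      real_inner_smul_right, real_inner_smul_left, real_inner_smul_left, real_inner_smul_right,
      horth, real_inner_comm (K.starProjection m) n, horth]
    simp only [real_inner_self_eq_norm_sq]
    ring
  have hsin := InnerProductGeometry.sin_angle_nonneg m n
  rw [← sq_eq_sq₀ hsin (by positivity), Real.sin_sq, InnerProductGeometry.cos_angle, hinner,
    div_pow, div_pow]
  field_simp
  linarith

theorem norm_starProjection_div_norm_of_mem_span (K : Submodule ℝ E) {m v : E}
    (hm : m ∈ Submodule.span ℝ {v}) (hm0 : m ≠ 0) :
    ‖K.starProjection m‖ / ‖m‖ = ‖K.starProjection v‖ / ‖v‖ := by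
  obtain ⟨c, rfl⟩ := Submodule.mem_span_singleton.1 hm
  have hc : ‖c‖ ≠ 0 := norm_ne_zero_iff.2 (by rintro rfl; simp at hm0)
  rw [map_smul, norm_smul, norm_smul, mul_div_mul_left _ _ hc]

/-- The sine of a dihedral angle of a hyperplane and an affine subspace. -/
theorem IsDihedralAngle.sin_eq {p v : E} {A : AffineSubspace ℝ E} {α : ℝ}
    (h : IsDihedralAngle (splitter p v) A α) :
    Real.sin α = ‖A.direction.starProjection v‖ / ‖v‖ := by
  have hS : (splitter p v).directionᗮ = Submodule.span ℝ {v} := by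
    rw [splitter, AffineSubspace.direction_mk', Submodule.orthogonal_orthogonal]
  rcases h with ⟨hd, m, hm, n, hn, hm0, hn0, rfl⟩ | ⟨-, m, hm, hm0, rfl⟩
  · rw [hS] at hm
    rw [sin_angle_of_mem_orthogonal hd hn hm0 hn0,
      norm_starProjection_div_norm_of_mem_span _ hm hm0]
  · rw [hS] at hm
    rw [Real.sin_pi_div_two_sub, cos_angle_starProjection,
      norm_starProjection_div_norm_of_mem_span _ hm hm0]

/-- Coordinates adapted to a subspace. -/
theorem exists_orthonormalBasis_norm_starProjection {d D : ℕ} (hD : Module.finrank ℝ E = D)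
    (hdD : d ≤ D) (K : Submodule ℝ E) (hK : Module.finrank ℝ K = d) :
    ∃ b : OrthonormalBasis (Fin D) ℝ E, ∀ x : E,
      ‖K.starProjection x‖ ^ 2 = ∑ j : Fin d, inner ℝ (b (Fin.castLE hdD j)) x ^ 2 := by
  let w : OrthonormalBasis (Fin d) ℝ K := (stdOrthonormalBasis ℝ K).reindex (finCongr hK)
  -- The value 0 beyond index `d` is a filler: only the first `d` vectors are kept when extending to
  -- a basis.
  let u : Fin D → E := fun i => if h : (i : ℕ) < d then (w ⟨i, h⟩ : E) else 0
  have hu : Orthonormal ℝ ({i : Fin D | (i : ℕ) < d}.domRestrict u) := by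
    have hw : Orthonormal ℝ (fun j => (w j : E)) :=
      w.orthonormal.comp_linearIsometry K.subtypeₗᵢ
    have := hw.comp (fun i : {i : Fin D | (i : ℕ) < d} => (⟨i.1, i.2⟩ : Fin d)) (by
      intro i j hij
      simpa [Fin.ext_iff, Subtype.ext_iff] using hij)
    convert! this using 1
    ext i
    have hi : ((i : Fin D) : ℕ) < d := i.2
    simp [u, hi]
  obtain ⟨b, hb⟩ := hu.exists_orthonormalBasis_extension_of_card_eq (by simpa using hD)
  refine ⟨b, fun x => ?_⟩
  have hbw (j : Fin d) : b (Fin.castLE hdD j) = (w j : E) := by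
    rw [hb _ (by simp)]
    simp [u]
  have h := w.sum_sq_inner_right (K.orthogonalProjectionOnto x)
  rw [K.starProjection_apply, ← Submodule.coe_norm, ← h]
  refine Finset.sum_congr rfl fun j _ => ?_
  rw [hbw, Submodule.inner_orthogonalProjectionOnto_eq_of_mem_left]

end Geometry

/-! ### A sequence of independent standard normal variables -/

/-- The law of a sequence of independent standard normal variables. -/
noncomputable def gaussianSeq : Measure (ℕ → ℝ) :=
  Measure.infinitePi fun _ => gaussianReal 0 1

instance isProbabilityMeasure_gaussianSeq : IsProbabilityMeasure gaussianSeq := by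
  unfold gaussianSeq; infer_instance

/-- The sum of the squares of the first `k` entries of a sequence. -/
def sqSum (k : ℕ) (x : ℕ → ℝ) : ℝ := ∑ i ∈ Finset.range k, x i ^ 2

theorem sqSum_nonneg (k : ℕ) (x : ℕ → ℝ) : 0 ≤ sqSum k x :=
  Finset.sum_nonneg fun _ _ => sq_nonneg _

@[fun_prop]
theorem measurable_sqSum (k : ℕ) : Measurable (sqSum k) := by
  unfold sqSum; fun_prop

theorem map_gaussianSeq_fin (k : ℕ) :
    gaussianSeq.map (fun x (i : Fin k) => x i) = Measure.pi fun _ => gaussianReal 0 1 := by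
  rw [gaussianSeq, Measure.map_infinitePi_infinitePi_of_inj Fin.val_injective,
    Measure.infinitePi_eq_pi]

theorem hasLaw_sqrt_sqSum (k : ℕ) :
    HasLaw (fun x => √(sqSum k x)) (chiMeasure k) gaussianSeq where
  map_eq := by
    rw [chiMeasure, ← map_gaussianSeq_fin, Measure.map_map (by fun_prop) (by fun_prop)]
    congr 1
    ext x
    simp [sqSum, Finset.sum_range]

/-- The joint law is needed because the two norms are dependent; both are read off from coordinates
in the same adapted basis. -/
theorem map_norm_starProjection_norm_stdGaussian {d D : ℕ}
    (K : Submodule ℝ (EuclideanSpace ℝ (Fin D))) (hK : Module.finrank ℝ K = d) :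
    (stdGaussian (EuclideanSpace ℝ (Fin D))).map (fun x => (‖K.starProjection x‖, ‖x‖)) =
      gaussianSeq.map fun x => (√(sqSum d x), √(sqSum D x)) := by
  have hD : Module.finrank ℝ (EuclideanSpace ℝ (Fin D)) = D := by simp
  have hdD : d ≤ D := by
    simpa [hK] using K.finrank_le
  obtain ⟨b, hb⟩ := exists_orthonormalBasis_norm_starProjection hD hdD K hK
  rw [stdGaussian_eq_map_pi_orthonormalBasis b, Measure.map_map (by fun_prop) (by fun_prop),
    ← map_gaussianSeq_fin, Measure.map_map (by fun_prop) (by fun_prop)]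
  congr 1
  have hin (x : ℕ → ℝ) (i : Fin D) : inner ℝ (b i) (∑ j : Fin D, x j • b j) = x i :=
    b.orthonormal.inner_right_fintype (fun j : Fin D => x j) i
  ext x
  · simp only [Function.comp_apply]
    rw [← Real.sqrt_sq (norm_nonneg (K.starProjection _)), hb]
    simp [hin, sqSum, Finset.sum_range]
  · simp only [Function.comp_apply]
    rw [← Real.sqrt_sq (norm_nonneg (∑ j : Fin D, x j • b j)), ← b.sum_sq_inner_right]
    simp [hin, sqSum, Finset.sum_range]

/-- If `Y` is independent of `X` and `F (x, Y)` has the law `ρ` for every value `x` of `X`, then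
`F (X, Y)` has the law `ρ`. -/
theorem ProbabilityTheory.IndepFun.hasLaw_of_forall_map_eq {Ω 𝓧 𝓨 𝓩 : Type*} [MeasurableSpace Ω]
    [MeasurableSpace 𝓧] [MeasurableSpace 𝓨] [MeasurableSpace 𝓩] {P : Measure Ω}
    [IsProbabilityMeasure P] {X : Ω → 𝓧} {Y : Ω → 𝓨} {F : 𝓧 × 𝓨 → 𝓩} {ρ : Measure 𝓩}
    (hX : AEMeasurable X P) (hY : AEMeasurable Y P) (h : IndepFun X Y P) (hF : Measurable F)
    (hρ : ∀ ω, (P.map Y).map (fun y => F (X ω, y)) = ρ) :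
    HasLaw (fun ω => F (X ω, Y ω)) ρ P := by
  refine ⟨hF.comp_aemeasurable (hX.prodMk hY), ?_⟩
  have hYp : IsProbabilityMeasure (P.map Y) := Measure.isProbabilityMeasure_map hY
  have hmap : P.map (fun ω => F (X ω, Y ω)) = ((P.map X).prod (P.map Y)).map F := by
    rw [← (indepFun_iff_map_prod_eq_prod_map_map hX hY).1 h,
      AEMeasurable.map_map_of_aemeasurable hF.aemeasurable (hX.prodMk hY)]
    rfl
  rw [hmap]
  ext s hs
  -- By Fubini the mass of `s` is an integral of section masses. Pulling it back along `X` to `Ω`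
  -- leaves only sections at attained values, where `hρ` applies.
  have hs' : Measurable fun x => P.map Y (Prod.mk x ⁻¹' (F ⁻¹' s)) :=
    measurable_measure_prodMk_left (hF hs)
  rw [Measure.map_apply hF hs, Measure.prod_apply (hF hs), lintegral_map' hs'.aemeasurable hX]
  have (ω : Ω) : P.map Y (Prod.mk (X ω) ⁻¹' (F ⁻¹' s)) = ρ s := by
    rw [← hρ ω, Measure.map_apply (by fun_prop) hs]
    rfl
  simp [this]

/-! ### The law of the sine of the dihedral angle -/

namespace IsRandomSplit

variable {Ω : Type*} [MeasurableSpace Ω] {P : Measure Ω} {d D : ℕ}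
  {IP : Ω → AffineSubspace ℝ (EuclideanSpace ℝ (Fin D))}
  {p v : Ω → EuclideanSpace ℝ (Fin D)} {α : Ω → ℝ}

/-- The joint law of `‖Π v‖` and `‖v‖`. -/
theorem identDistrib_norm [IsProbabilityMeasure P]
    (h : IsRandomSplit P d D IP p v α) :
    IdentDistrib (fun ω => (‖(IP ω).direction.starProjection (v ω)‖, ‖v ω‖))
      (fun x => (√(sqSum d x), √(sqSum D x))) P gaussianSeq := by
  have hF : Measurable fun q : (EuclideanSpace ℝ (Fin D) →L[ℝ] EuclideanSpace ℝ (Fin D)) ×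
      EuclideanSpace ℝ (Fin D) => (‖q.1 q.2‖, ‖q.2‖) :=
    Continuous.measurable (by fun_prop)
  have hv := h.hasLaw_normal.aemeasurable
  have hlaw : HasLaw (fun ω => (‖(IP ω).direction.starProjection (v ω)‖, ‖v ω‖))
      (gaussianSeq.map fun x => (√(sqSum d x), √(sqSum D x))) P := by
    refine h.indepFun.hasLaw_of_forall_map_eq h.aemeasurable_direction hv hF fun ω => ?_
    rw [h.hasLaw_normal.map_eq]
    exact map_norm_starProjection_norm_stdGaussian _ (h.finrank_direction ω)
  exact ⟨hlaw.aemeasurable, by fun_prop, hlaw.map_eq⟩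

theorem ae_sin_eq (h : IsRandomSplit P d D IP p v α) :
    ∀ᵐ ω ∂P, Real.sin (α ω) = ‖(IP ω).direction.starProjection (v ω)‖ / ‖v ω‖ := by
  filter_upwards [h.isDihedralAngle] with ω hω using hω.sin_eq

/-- The sine of the dihedral angle is distributed as a quotient of norms of initial segments of a
sequence of independent standard normal variables. -/
theorem identDistrib_sin [IsProbabilityMeasure P]
    (h : IsRandomSplit P d D IP p v α) :
    IdentDistrib (fun ω => Real.sin (α ω)) (fun x => √(sqSum d x) / √(sqSum D x))
      P gaussianSeq := by
  have hq := h.identDistrib_norm.comp (u := fun q : ℝ × ℝ => q.1 / q.2) (by fun_prop)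
  have hae : (fun ω => Real.sin (α ω)) =ᵐ[P]
      ((fun q : ℝ × ℝ => q.1 / q.2) ∘
        fun ω => (‖(IP ω).direction.starProjection (v ω)‖, ‖v ω‖)) := h.ae_sin_eq
  exact ⟨hq.aemeasurable_fst.congr hae.symm, hq.aemeasurable_snd,
    (Measure.map_congr hae).trans hq.map_eq⟩

end IsRandomSplit

/-! ### General facts on convergence in distribution -/

/-- Convergence in distribution only depends on the laws of the random variables. -/
theorem MeasureTheory.TendstoInDistribution.of_identDistrib {ι E Ω₁ Ω₁' : Type*} {Ω Ω' : ι → Type*}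
    {m : ∀ i, MeasurableSpace (Ω i)} {μ : ∀ i, Measure (Ω i)} [∀ i, IsProbabilityMeasure (μ i)]
    {m' : ∀ i, MeasurableSpace (Ω' i)} {μ' : ∀ i, Measure (Ω' i)}
    [∀ i, IsProbabilityMeasure (μ' i)]
    {m₁ : MeasurableSpace Ω₁} {ν : Measure Ω₁} [IsProbabilityMeasure ν]
    {m₁' : MeasurableSpace Ω₁'} {ν' : Measure Ω₁'} [IsProbabilityMeasure ν']
    [TopologicalSpace E] [MeasurableSpace E] [OpensMeasurableSpace E] {l : Filter ι}
    {X : ∀ i, Ω i → E} {Y : ∀ i, Ω' i → E} {Z : Ω₁ → E} {T : Ω₁' → E}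
    (h : TendstoInDistribution Y l T μ' ν') (hXY : ∀ i, IdentDistrib (X i) (Y i) (μ i) (μ' i))
    (hZT : IdentDistrib Z T ν ν') : TendstoInDistribution X l Z μ ν where
  forall_aemeasurable i := (hXY i).aemeasurable_fst
  aemeasurable_limit := hZT.aemeasurable_fst
  tendsto := by
    convert! h.tendsto using 1
    · congr 1
      funext i
      exact Subtype.ext (hXY i).map_eq
    · congr 1
      exact Subtype.ext hZT.map_eq

/-- Convergence in distribution to a constant implies convergence in probability. -/
theorem MeasureTheory.TendstoInDistribution.tendstoInMeasure_const {ι E Ω Ω' : Type*}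
    {m : MeasurableSpace Ω} {μ : Measure Ω} [IsProbabilityMeasure μ]
    {m' : MeasurableSpace Ω'} {ν : Measure Ω'} [IsProbabilityMeasure ν]
    [PseudoMetricSpace E] [MeasurableSpace E] [OpensMeasurableSpace E]
    {l : Filter ι} {X : ι → Ω → E} {c : E}
    (h : TendstoInDistribution X l (fun _ : Ω' => c) (fun _ => μ) ν) :
    TendstoInMeasure μ X l fun _ => c := by
  rw [tendstoInMeasure_iff_dist]
  intro ε hε
  -- Portmanteau for a closed set that the Dirac mass at `c` does not charge.
  have hcl : IsClosed {x : E | ε ≤ dist x c} := isClosed_le continuous_const (by fun_prop)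
  have hlim := ProbabilityMeasure.limsup_measure_closed_le_of_tendsto h.tendsto hcl
  have h0 : ν.map (fun _ => c) {x : E | ε ≤ dist x c} = 0 := by
    rw [Measure.map_apply measurable_const hcl.measurableSet]
    simp [hε.not_ge]
  simp only [ProbabilityMeasure.coe_mk, h0] at hlim
  refine tendsto_of_le_liminf_of_limsup_le zero_le (hlim.trans_eq' ?_)
  congr 1
  ext i
  rw [Measure.map_apply_of_aemeasurable (h.forall_aemeasurable i) hcl.measurableSet]
  rfl

/-! ### Limit theorems for sums of squares of standard normal variables -/

theorem integral_sq_gaussianReal : ∫ x, x ^ 2 ∂gaussianReal 0 1 = 1 := by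
  have h := variance_id_gaussianReal (μ := 0) (v := 1)
  rw [variance_of_integral_eq_zero aemeasurable_id (by simp)] at h
  simpa using h

theorem integral_pow_four_gaussianReal : ∫ x, x ^ 4 ∂gaussianReal 0 1 = 3 := by
  have h := iteratedDeriv_mgf_zero (X := fun x : ℝ => x) (μ := gaussianReal 0 1) (by simp) 4
  -- Differentiating `f(t) exp(t²/2)` replaces `f` by `f' + t f`. Four rounds give `1, t, 1 + t², 3t
  -- + t³, 3 + 6t² + t⁴`, with value 3 at 0.
  have hd (f f' : ℝ → ℝ) (hf : ∀ t, HasDerivAt f (f' t) t) :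
      deriv (fun t => f t * Real.exp (t ^ 2 / 2)) =
        fun t => (f' t + t * f t) * Real.exp (t ^ 2 / 2) := by
    ext t
    have h1 : HasDerivAt (fun t : ℝ => t ^ 2 / 2) t t := by
      simpa using (hasDerivAt_pow 2 t).div_const 2
    rw [((hf t).fun_mul h1.exp).deriv]
    ring
  have hm : mgf (fun x : ℝ => x) (gaussianReal 0 1) = fun t => 1 * Real.exp (t ^ 2 / 2) := by
    rw [mgf_fun_id_gaussianReal]
    ext t
    simp
  rw [hm, iteratedDeriv_succ, iteratedDeriv_succ, iteratedDeriv_succ, iteratedDeriv_one,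
    hd (fun _ => 1) (fun _ => 0) fun t => hasDerivAt_const t _,
    hd _ (fun _ => 1) fun t => by simpa using hasDerivAt_id' t,
    hd _ (fun t => 2 * t) fun t => by
      simpa [← sq] using (hasDerivAt_pow 2 t).const_add 1,
    hd _ (fun t => 3 + 3 * t ^ 2) fun t => by
      have h3 : HasDerivAt (fun t : ℝ => 3 * t + t ^ 3) (3 + 3 * t ^ 2) t := by
        simpa using ((hasDerivAt_id' t).const_mul 3).fun_add (hasDerivAt_pow 3 t)
      convert! h3 using 1
      ext t
      ring] at h
  simpa using h.symm

theorem integrable_pow_gaussianReal (n : ℕ) : Integrable (fun x : ℝ => x ^ n) (gaussianReal 0 1) :=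
  integrable_pow_of_mem_interior_integrableExpSet (X := fun x : ℝ => x) (by simp) n

theorem identDistrib_eval_gaussianSeq (i : ℕ) :
    IdentDistrib (fun x : ℕ → ℝ => x i) (fun x => x 0) gaussianSeq gaussianSeq :=
  ⟨(measurable_pi_apply i).aemeasurable, (measurable_pi_apply 0).aemeasurable, by
    rw [gaussianSeq, Measure.infinitePi_map_eval, Measure.infinitePi_map_eval]⟩

theorem integral_comp_eval_gaussianSeq {f : ℝ → ℝ} (hf : Measurable f) (i : ℕ) :
    ∫ x, f (x i) ∂gaussianSeq = ∫ t, f t ∂gaussianReal 0 1 := by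
  rw [← Measure.infinitePi_map_eval (fun _ : ℕ => gaussianReal 0 1) i,
    integral_map (measurable_pi_apply i).aemeasurable hf.aestronglyMeasurable, gaussianSeq]

/-- The law of large numbers for the squares of independent standard normal variables. -/
theorem ae_tendsto_sqSum_div :
    ∀ᵐ x ∂gaussianSeq, Tendsto (fun k : ℕ => sqSum k x / k) atTop (𝓝 1) := by
  have hind : iIndepFun (fun i (x : ℕ → ℝ) => x i ^ 2) gaussianSeq :=
    iIndepFun_infinitePi (X := fun _ t => t ^ 2) (by fun_prop)
  have hint : Integrable (fun x : ℕ → ℝ => x 0 ^ 2) gaussianSeq :=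
    (measurePreserving_eval_infinitePi
      (fun _ : ℕ => gaussianReal 0 1) 0).integrable_comp_of_integrable
      (integrable_pow_gaussianReal 2)
  have h := strong_law_ae_real (fun i (x : ℕ → ℝ) => x i ^ 2) hint
    (fun i j hij => hind.indepFun hij)
    fun i => (identDistrib_eval_gaussianSeq i).comp (u := fun t => t ^ 2) (by fun_prop)
  rw [integral_comp_eval_gaussianSeq (f := fun t => t ^ 2) (by fun_prop),
    integral_sq_gaussianReal] at h
  exact h

theorem ae_sqSum_pos : ∀ᵐ x ∂gaussianSeq, ∀ k, 1 ≤ k → 0 < sqSum k x := by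
  have h0 : ∀ᵐ x ∂gaussianSeq, x 0 ≠ 0 := by
    have := (measurePreserving_eval_infinitePi
      (fun _ : ℕ => gaussianReal 0 1) 0).quasiMeasurePreserving.ae (p := fun t => t ≠ 0)
      (by
        have := nullSingletonClass_gaussianReal (μ := 0) (v := 1) one_ne_zero
        simp [ae_iff])
    exact this
  filter_upwards [h0] with x hx k hk
  exact Finset.sum_pos' (fun _ _ => sq_nonneg _) ⟨0, Finset.mem_range.2 hk, by positivity⟩

/-- The central limit theorem for the squares of independent standard normal variables. -/
theorem tendstoInDistribution_sqSum :
    TendstoInDistribution (fun (k : ℕ) x => (√k)⁻¹ * ((sqSum k x - k) / √2)) atTop id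
      (fun _ => gaussianSeq) (gaussianReal 0 1) := by
  have hind : iIndepFun (fun i (x : ℕ → ℝ) => (x i ^ 2 - 1) / √2) gaussianSeq :=
    iIndepFun_infinitePi (X := fun _ t => (t ^ 2 - 1) / √2) (by fun_prop)
  have h := tendstoInDistribution_inv_sqrt_mul_sum (X := fun i (x : ℕ → ℝ) => (x i ^ 2 - 1) / √2)
    (HasLaw.id (μ := gaussianReal 0 1)) ?_ ?_ hind
    fun i => (identDistrib_eval_gaussianSeq i).comp (u := fun t => (t ^ 2 - 1) / √2) (by fun_prop)
  · convert! h using 4 with k x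
    rw [← Finset.sum_div, Finset.sum_sub_distrib]
    simp [sqSum]
  · rw [integral_comp_eval_gaussianSeq (f := fun t => (t ^ 2 - 1) / √2) (by fun_prop),
      integral_div, integral_sub (integrable_pow_gaussianReal 2) (integrable_const _),
      integral_sq_gaussianReal]
    simp
  · change ∫ x : ℕ → ℝ, ((x 0 ^ 2 - 1) / √2) ^ 2 ∂gaussianSeq = 1
    rw [integral_comp_eval_gaussianSeq (f := fun t => ((t ^ 2 - 1) / √2) ^ 2) (by fun_prop)]
    -- The square of a standard normal has variance `3 - 1 = 2`, whence the normalization by `√2`.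
    have (t : ℝ) : ((t ^ 2 - 1) / √2) ^ 2 = (t ^ 4 - 2 * t ^ 2 + 1) / 2 := by
      rw [div_pow, Real.sq_sqrt (by norm_num)]
      ring
    simp_rw [this]
    rw [integral_div, integral_add, integral_sub, integral_const_mul, integral_sq_gaussianReal,
      integral_pow_four_gaussianReal]
    · norm_num
    · exact integrable_pow_gaussianReal 4
    · exact (integrable_pow_gaussianReal 2).const_mul 2
    · exact (integrable_pow_gaussianReal 4).sub ((integrable_pow_gaussianReal 2).const_mul 2)
    · exact integrable_const _

/-! ### Deterministic consequences of `S_k / k → 1` -/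

section Pointwise

variable {x : ℕ → ℝ}

theorem tendsto_sqrt_sub_div_sqrt_natCast (a : ℝ) :
    Tendsto (fun k : ℕ => √(k - a) / √k) atTop (𝓝 1) := by
  have h : Tendsto (fun k : ℕ => √(1 - a / k)) atTop (𝓝 1) := by
    simpa using ((tendsto_const_div_atTop_nhds_zero_nat a).const_sub 1).sqrt
  refine h.congr' ?_
  filter_upwards [eventually_gt_atTop 0] with k hk
  have : (0 : ℝ) < k := by exact_mod_cast hk
  rw [← Real.sqrt_div' _ this.le, sub_div, div_self this.ne']

theorem tendsto_sqrt_sqSum_div_sqrt_natCast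
    (hx : Tendsto (fun k : ℕ => sqSum k x / k) atTop (𝓝 1)) :
    Tendsto (fun k : ℕ => √(sqSum k x) / √k) atTop (𝓝 1) := by
  have h := hx.sqrt
  rw [Real.sqrt_one] at h
  exact h.congr fun k => Real.sqrt_div' _ k.cast_nonneg

theorem tendsto_sqrt_sub_div_sqrt_sqSum (a : ℝ)
    (hx : Tendsto (fun k : ℕ => sqSum k x / k) atTop (𝓝 1)) :
    Tendsto (fun k : ℕ => √(k - a) / √(sqSum k x)) atTop (𝓝 1) := by
  have h := (tendsto_sqrt_sub_div_sqrt_natCast a).div (tendsto_sqrt_sqSum_div_sqrt_natCast hx)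
    one_ne_zero
  rw [div_one] at h
  refine h.congr' ?_
  filter_upwards [eventually_gt_atTop 0] with k hk
  have : √(k : ℝ) ≠ 0 := (Real.sqrt_pos.2 (by exact_mod_cast hk)).ne'
  exact div_div_div_cancel_right₀ this _ _

/-- With `a = 1/2`, this is the factor that turns the normalized `S_k - k` into `√2 (√S_k - √(k -
1/2))`, up to an additive error controlled by `tendsto_const_div_sqrt_add`. -/
theorem tendsto_two_mul_sqrt_div_add (a : ℝ)
    (hx : Tendsto (fun k : ℕ => sqSum k x / k) atTop (𝓝 1)) :
    Tendsto (fun k : ℕ => 2 * √k / (√(sqSum k x) + √(k - a))) atTop (𝓝 1) := by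
  have h := (tendsto_const_nhds (x := (2 : ℝ))).div
    ((tendsto_sqrt_sqSum_div_sqrt_natCast hx).add (tendsto_sqrt_sub_div_sqrt_natCast a))
    (by norm_num)
  rw [show (2 : ℝ) / (1 + 1) = 1 by norm_num] at h
  refine h.congr fun k => ?_
  rw [Pi.div_apply, ← add_div, div_div_eq_mul_div]

theorem tendsto_const_div_sqrt_add (a c : ℝ)
    (hx : Tendsto (fun k : ℕ => sqSum k x / k) atTop (𝓝 1)) :
    Tendsto (fun k : ℕ => c / (√(sqSum k x) + √(k - a))) atTop (𝓝 0) := by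
  have h0 : Tendsto (fun k : ℕ => (c / 2) / √(k : ℝ)) atTop (𝓝 0) :=
    (Real.tendsto_sqrt_atTop.comp tendsto_natCast_atTop_atTop).const_div_atTop _
  have h := h0.mul (tendsto_two_mul_sqrt_div_add a hx)
  rw [zero_mul] at h
  refine h.congr' ?_
  filter_upwards [eventually_gt_atTop 0] with k hk
  have : √(k : ℝ) ≠ 0 := (Real.sqrt_pos.2 (by exact_mod_cast hk)).ne'
  rw [div_mul_div_comm, show c / 2 * (2 * √(k : ℝ)) = √(k : ℝ) * c by ring, mul_div_mul_left _ _ this]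

end Pointwise

/-- A deterministic rescaling of `√(sqSum d)` by the norm of a long Gaussian vector does not change
its law in the limit. -/
theorem tendstoInDistribution_sqrt_mul_sqrt_sqSum_div (a : ℝ) (d : ℕ) {D : ℕ → ℕ}
    (hD : Tendsto D atTop atTop) :
    TendstoInDistribution (fun n x => √((D n : ℝ) - a) * (√(sqSum d x) / √(sqSum (D n) x))) atTop
      (fun x => √(sqSum d x)) (fun _ => gaussianSeq) gaussianSeq := by
  refine tendstoInDistribution_of_ae_tendsto (fun n => by fun_prop) (by fun_prop) ?_
  filter_upwards [ae_tendsto_sqSum_div] with x hx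
  have h := ((tendsto_sqrt_sub_div_sqrt_sqSum a hx).comp hD).const_mul √(sqSum d x)
  rw [mul_one] at h
  refine h.congr fun n => ?_
  simp only [Function.comp_apply]
  ring

/-- Fisher's normal approximation of the chi distribution. -/
theorem tendstoInDistribution_sqrt_sqSum_sub :
    TendstoInDistribution (fun (k : ℕ) x => √2 * (√(sqSum k x) - √((k : ℝ) - 1 / 2))) atTop id
      (fun _ => gaussianSeq) (gaussianReal 0 1) := by
  have hfac : TendstoInMeasure gaussianSeq
      (fun (k : ℕ) x => (2 * √k / (√(sqSum k x) + √((k : ℝ) - 1 / 2)),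
        (√2 / 2) / (√(sqSum k x) + √((k : ℝ) - 1 / 2)))) atTop fun _ => ((1 : ℝ), (0 : ℝ)) := by
    refine tendstoInMeasure_of_tendsto_ae
      (fun k => Measurable.aestronglyMeasurable (by fun_prop)) ?_
    filter_upwards [ae_tendsto_sqSum_div] with x hx
    exact (tendsto_two_mul_sqrt_div_add _ hx).prodMk_nhds (tendsto_const_div_sqrt_add _ _ hx)
  -- Slutsky, based on `s - b = (s² - b²) / (s + b)` with `s² - b² = (S_k - k) + 1/2`.
  have h := tendstoInDistribution_sqSum.continuous_comp_prodMk_of_tendstoInMeasure_const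
    (g := fun q : ℝ × ℝ × ℝ => q.1 * q.2.1 + q.2.2) (by fun_prop) hfac (fun k => by fun_prop)
  refine h.congr (fun k => Eventually.of_forall fun x => ?_)
    (Eventually.of_forall fun z => by simp)
  rcases Nat.eq_zero_or_pos k with rfl | hk
  · have h0 : √(-2⁻¹ : ℝ) = 0 := Real.sqrt_eq_zero_of_nonpos (by norm_num)
    simp [sqSum, h0]
  have hk1 : (1 : ℝ) ≤ k := by exact_mod_cast hk
  have hk0 : 0 < √(k : ℝ) := Real.sqrt_pos.2 (by linarith)
  have hb : 0 < √((k : ℝ) - 1 / 2) := Real.sqrt_pos.2 (by linarith)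
  have hb2 : √((k : ℝ) - 1 / 2) ^ 2 = k - 1 / 2 := Real.sq_sqrt (by linarith)
  have hs2 : √(sqSum k x) ^ 2 = sqSum k x := Real.sq_sqrt (sqSum_nonneg k x)
  have hden : 0 < √(sqSum k x) + √((k : ℝ) - 1 / 2) := by positivity
  have h2 : √(2 : ℝ) ^ 2 = 2 := Real.sq_sqrt (by norm_num)
  have h20 : 0 < √(2 : ℝ) := by positivity
  set s := √(sqSum k x)
  set b := √((k : ℝ) - 1 / 2)
  set r := √(2 : ℝ)
  have hdiff : sqSum k x - k = s ^ 2 - b ^ 2 - 1 / 2 := by rw [hs2, hb2]; ring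
  simp only [hdiff]
  field_simp
  rw [h2]
  ring

/-- The quotient of the norms of two initial segments of a Gaussian sequence is asymptotically
normal if the ratio of their lengths tends to zero. -/
theorem tendstoInDistribution_sqrt_sqSum_div {d D : ℕ → ℕ} (hd : Tendsto d atTop atTop)
    (hD : Tendsto D atTop atTop) (hdD : Tendsto (fun n => (d n : ℝ) / (D n : ℝ)) atTop (𝓝 0)) :
    TendstoInDistribution
      (fun n x => (√(sqSum (d n) x) / √(sqSum (D n) x) -
        √((d n : ℝ) - 1 / 2) / √((D n : ℝ) - 1 / 2)) / √(1 / (2 * (D n : ℝ) - 1))) atTop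
      id (fun _ => gaussianSeq) (gaussianReal 0 1) := by
  let U : ℕ → (ℕ → ℝ) → ℝ := fun k x => √2 * (√(sqSum k x) - √((k : ℝ) - 1 / 2))
  have hU : TendstoInDistribution U atTop id (fun _ => gaussianSeq) (gaussianReal 0 1) :=
    tendstoInDistribution_sqrt_sqSum_sub
  have hUcomp {e : ℕ → ℕ} (he : Tendsto e atTop atTop) : TendstoInDistribution
      (fun n => U (e n)) atTop id (fun _ => gaussianSeq) (gaussianReal 0 1) :=
    ⟨fun n => hU.forall_aemeasurable _, hU.aemeasurable_limit, hU.tendsto.comp he⟩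
  have hc : TendstoInMeasure gaussianSeq
      (fun n x => √((D n : ℝ) - 1 / 2) / √(sqSum (D n) x)) atTop fun _ => (1 : ℝ) := by
    refine tendstoInMeasure_of_tendsto_ae
      (fun k => Measurable.aestronglyMeasurable (by fun_prop)) ?_
    filter_upwards [ae_tendsto_sqSum_div] with x hx
    exact (tendsto_sqrt_sub_div_sqrt_sqSum _ hx).comp hD
  have hratio : Tendsto (fun n => √((d n : ℝ) - 1 / 2) / √(D n : ℝ)) atTop (𝓝 0) := by
    have h := (hdD.sub ((tendsto_const_div_atTop_nhds_zero_nat (1 / 2)).comp hD)).sqrt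
    rw [sub_zero, Real.sqrt_zero] at h
    refine h.congr fun n => ?_
    rw [← Real.sqrt_div' _ (Nat.cast_nonneg _), sub_div]
    rfl
  have he : TendstoInMeasure gaussianSeq
      (fun n x => √((d n : ℝ) - 1 / 2) / √(sqSum (D n) x)) atTop fun _ => (0 : ℝ) := by
    refine tendstoInMeasure_of_tendsto_ae
      (fun k => Measurable.aestronglyMeasurable (by fun_prop)) ?_
    filter_upwards [ae_tendsto_sqSum_div] with x hx
    have h := hratio.mul ((tendsto_sqrt_sub_div_sqrt_sqSum 0 hx).comp hD)
    rw [zero_mul] at h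
    refine h.congr' ?_
    filter_upwards [hD.eventually_gt_atTop 0] with n hn
    have : √(D n : ℝ) ≠ 0 := (Real.sqrt_pos.2 (by exact_mod_cast hn)).ne'
    simp only [Function.comp_apply, sub_zero]
    field_simp
  have hsmall : TendstoInMeasure gaussianSeq
      (fun n x => -(U (D n) x * (√((d n : ℝ) - 1 / 2) / √(sqSum (D n) x)))) atTop
      fun _ => (0 : ℝ) := by
    -- A sequence converging in law times one tending to 0 in probability has limit 0 in law, hence
    -- in probability.
    have h := (hUcomp hD).continuous_comp_prodMk_of_tendstoInMeasure_const
      (g := fun q : ℝ × ℝ => -(q.1 * q.2)) (by fun_prop) he (fun n => by fun_prop)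
    simp only [mul_zero, neg_zero] at h
    exact h.tendstoInMeasure_const
  have hmain := ((hUcomp hd).continuous_comp_prodMk_of_tendstoInMeasure_const
    (g := fun q : ℝ × ℝ => q.1 * q.2) (by fun_prop) hc
    (fun n => by fun_prop)).add_of_tendstoInMeasure_const hsmall (fun n => by fun_prop)
  refine hmain.congr (fun n => ?_) (Eventually.of_forall fun z => by simp)
  filter_upwards [ae_sqSum_pos] with x hx
  -- For `D n = 0` both sides vanish, since division by zero and the square root of a negative
  -- number are 0.
  rcases Nat.eq_zero_or_pos (D n) with h0 | hn
  · have h1 : √(-2⁻¹ : ℝ) = 0 := Real.sqrt_eq_zero_of_nonpos (by norm_num)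
    simp [h0, sqSum, h1]
  have hn1 : (1 : ℝ) ≤ D n := by exact_mod_cast hn
  have hS : 0 < √(sqSum (D n) x) := Real.sqrt_pos.2 (hx _ hn)
  have hB : 0 < √((D n : ℝ) - 1 / 2) := Real.sqrt_pos.2 (by linarith)
  have h20 : 0 < √(2 : ℝ) := by positivity
  have hsd : √(1 / (2 * (D n : ℝ) - 1)) = 1 / (√2 * √((D n : ℝ) - 1 / 2)) := by
    rw [← Real.sqrt_mul (by norm_num), Real.sqrt_div zero_le_one, Real.sqrt_one]
    ring_nf
  simp only [Pi.add_apply, hsd, U]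
  generalize √((D n : ℝ) - 1 / 2) = B at hB ⊢
  generalize √((d n : ℝ) - 1 / 2) = b
  field_simp
  ring

theorem theorem1 :
    -- `sin α` is the quotient of a `χ_d` variable and a `χ_D` variable
    (∀ (d D : ℕ) (Ω : Type*) [MeasurableSpace Ω] (P : Measure Ω) [IsProbabilityMeasure P]
        (IP : Ω → AffineSubspace ℝ (EuclideanSpace ℝ (Fin D)))
        (p v : Ω → EuclideanSpace ℝ (Fin D)) (α : Ω → ℝ),
        1 ≤ d → IsRandomSplit P d D IP p v α →
        HasLaw (fun ω => ‖(IP ω).direction.starProjection (v ω)‖) (chiMeasure d) P ∧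
        HasLaw (fun ω => ‖v ω‖) (chiMeasure D) P ∧
        ∀ᵐ ω ∂P, Real.sin (α ω) = ‖(IP ω).direction.starProjection (v ω)‖ / ‖v ω‖) ∧
    -- `d` fixed, `D → ∞`
    (∀ (d : ℕ) (D : ℕ → ℕ) (Ω : ℕ → Type*) [∀ n, MeasurableSpace (Ω n)]
        (P : ∀ n, Measure (Ω n)) [∀ n, IsProbabilityMeasure (P n)]
        (IP : ∀ n, Ω n → AffineSubspace ℝ (EuclideanSpace ℝ (Fin (D n))))
        (p v : ∀ n, Ω n → EuclideanSpace ℝ (Fin (D n))) (α : ∀ n, Ω n → ℝ),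
        1 ≤ d → (∀ n, IsRandomSplit (P n) d (D n) (IP n) (p n) (v n) (α n)) →
        Tendsto D atTop atTop →
        TendstoInDistribution (fun n ω => √((D n : ℝ) - 1 / 2) * Real.sin (α n ω)) atTop
          id P (chiMeasure d) ∧
        TendstoInDistribution (fun n ω => √(D n : ℝ) * Real.sin (α n ω)) atTop
          id P (chiMeasure d)) ∧
    -- `d → ∞` and `D → ∞` with `d / D → 0`
    (∀ (d D : ℕ → ℕ) (Ω : ℕ → Type*) [∀ n, MeasurableSpace (Ω n)]
        (P : ∀ n, Measure (Ω n)) [∀ n, IsProbabilityMeasure (P n)]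
        (IP : ∀ n, Ω n → AffineSubspace ℝ (EuclideanSpace ℝ (Fin (D n))))
        (p v : ∀ n, Ω n → EuclideanSpace ℝ (Fin (D n))) (α : ∀ n, Ω n → ℝ),
        (∀ n, IsRandomSplit (P n) (d n) (D n) (IP n) (p n) (v n) (α n)) →
        Tendsto d atTop atTop → Tendsto D atTop atTop →
        Tendsto (fun n => (d n : ℝ) / (D n : ℝ)) atTop (𝓝 0) →
        TendstoInDistribution
          (fun n ω => (Real.sin (α n ω) - √((d n : ℝ) - 1 / 2) / √((D n : ℝ) - 1 / 2)) /
            √(1 / (2 * (D n : ℝ) - 1))) atTop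
          id P (gaussianReal 0 1)) := by

  refine ⟨?_, ?_, ?_⟩
  · intro d D Ω _ P _ IP p v α _ h
    have hn := h.identDistrib_norm
    have h1 := hn.comp (u := Prod.fst) measurable_fst
    have h2 := hn.comp (u := Prod.snd) measurable_snd
    exact ⟨⟨h1.aemeasurable_fst, h1.map_eq.trans (hasLaw_sqrt_sqSum d).map_eq⟩,
      ⟨h2.aemeasurable_fst, h2.map_eq.trans (hasLaw_sqrt_sqSum D).map_eq⟩, h.ae_sin_eq⟩
  · intro d D Ω _ P _ IP p v α _ h hD
    have hlim : IdentDistrib id (fun x => √(sqSum d x)) (chiMeasure d) gaussianSeq :=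
      ⟨aemeasurable_id, by fun_prop, by rw [Measure.map_id, (hasLaw_sqrt_sqSum d).map_eq]⟩
    refine ⟨(tendstoInDistribution_sqrt_mul_sqrt_sqSum_div (1 / 2) d hD).of_identDistrib
      (fun n => ?_) hlim, ?_⟩
    · exact (h n).identDistrib_sin.comp (u := fun s => √((D n : ℝ) - 1 / 2) * s) (by fun_prop)
    · have h0 := tendstoInDistribution_sqrt_mul_sqrt_sqSum_div 0 d hD
      simp only [sub_zero] at h0
      exact h0.of_identDistrib (fun n =>
        (h n).identDistrib_sin.comp (u := fun s => √(D n : ℝ) * s) (by fun_prop)) hlim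
  · intro d D Ω _ P _ IP p v α h hd hD hdD
    exact (tendstoInDistribution_sqrt_sqSum_div hd hD hdD).of_identDistrib (fun n =>
      (h n).identDistrib_sin.comp
        (u := fun s => (s - √((d n : ℝ) - 1 / 2) / √((D n : ℝ) - 1 / 2)) /
          √(1 / (2 * (D n : ℝ) - 1))) (by fun_prop)) (IdentDistrib.refl aemeasurable_id)
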